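/- **Notation.** All spaces $\mathbb R^n$ and their products carry the Euclidean norm. For a set $A\subseteq\mathbb R^s$ and $x\in A$ let $$T_A(x)=\{w \mid \exists\, t_i\downarrow 0,\ w_i\to w \text{ with } x+t_iw_i\in A\ \forall i\}$$ be the tangent cone, $T^\sharp_A(x)=\{w\mid \exists\, x_i\to x,\ x_i\in A,\ w_i\in T_A(x_i),\ w_i\to w\}$ the outer limiting tangent cone, and $\widehat N_A(x)=\{x^*\mid \langle x^*,w\rangle\le 0\ \forall w\in T_A(x)\}$ the regular normal cone. $A$ is *semismooth\** at $x\in A$ if for every $\epsilon>0$ there is $\delta>0$ with $|\langle z^*,z-x\rangle|\le\epsilon\|z-x\|\,\|z^*\|$ for all $z\in A$ with $\|z-x\|\le\delta$ and all $z^*\in\widehat N_A(z)$. For a multifunction $F:\mathbb R^n\rightrightarrows\mathbb R^m$ and $p\in\operatorname{gph}F$ the multifunctions $DF(p),D^\sharp F(p):\mathbb R^n\rightrightarrows\mathbb R^m$ and $\widehat D^*F(p):\mathbb R^m\rightrightarrows\mathbb R^n$ are defined by $$\operatorname{gph}DF(p)=T_{\operatorname{gph}F}(p),\quad \operatorname{gph}D^\sharp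 F(p)=T^\sharp_{\operatorname{gph}F}(p),\quad \operatorname{gph}\widehat D^*F(p)=\{(y^*,x^*)\mid (x^*,-y^*)\in\widehat N_{\operatorname{gph}F}(p)\}.$$ $F$ is semismooth\* at $p$ if $\operatorname{gph}F$ is. Let $\mathcal Z_{nm}$ be the set of $n$-dimensional subspaces of $\mathbb R^{n}\times\mathbb R^m$ with the metric $\|P_{L_1}-P_{L_2}\|$ (operator norm of the difference of the orthogonal projections), and let $\mathcal O_F$ be the set of $p\in\operatorname{gph}F$ with $T_{\operatorname{gph}F}(p)\in\mathcal Z_{nm}$. The SC limiting graphical derivative $\mathcal SF(p)\subseteq\mathcal Z_{nm}$ consists of all limits in $\mathcal Z_{nm}$ of $\operatorname{gph}DF(p_i)$, and the SC limiting coderivative $\mathcal S^*F(p)\subseteq\mathcal Z_{mn}$ of all limits in $\mathcal Z_{mn}$ of $\operatorname{gph}\widehat D^*F(p_i)$, along sequences $p_i\to p$ in $\mathcal O_F$. $F$ has the *SCD property* at $p$ if $\mathcal S^*F(p)\neq\emptyset$. $F$ has the SCD property (is semismooth\*) *around* $p$ if this holds at all points of $\operatorname{gph}F\cap W$ for some neighborhood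 $W$ of $p$. A multifunction $S:\mathbb R^l\rightrightarrows\mathbb R^k$ is *isolatedly calm around* $(\bar x,\bar y)\in\operatorname{gph}S$ if there are $\kappa\ge0$ and a neighborhood $W$ of $(\bar x,\bar y)$ such that every $(x,y)\in\operatorname{gph}S\cap W$ admits a neighborhood $U$ of $y$ with $\|y'-y\|\le\kappa\|x'-x\|$ for all $x'\in\mathbb R^l$ and $y'\in S(x')\cap U$. **Theorem.** Let $H:\mathbb R^l\times\mathbb R^k\rightrightarrows\mathbb R^k$ be a multifunction, let $\Sigma(x)=\{y\mid 0\in H(x,y)\}$, and let $((\bar x,\bar y),0)\in\operatorname{gph}H$. Then each of the following two conditions ensures that $\Sigma$ is isolatedly calm around $(\bar x,\bar y)$. (i) $0\in D^\sharp H((\bar x,\bar y),0)(0,v)\ \Rightarrow\ v=0$. (ii) $H$ has both the SCD property and the semismooth\* property around $((\bar x,\bar y),0)$, and either $$((0,v),0)\in L\ \Rightarrow\ v=0\qquad\text{for all } L\in\mathcal SH((\bar x,\bar y),0),\tag{P}$$ or $$(w^*,(u^*,0))\in L^*\ \Rightarrow\ w^*=0,\ u^*=0\qquad\text{for all } L^*\in\mathcal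 S^*H((\bar x,\bar y),0).\tag{D}$$ Moreover, (P) and (D) are equivalent. -/

import Mathlib

open Filter Topology

namespace SCD

/-! ### Product spaces, graphs of multifunctions -/

/-- The product `E × F` with the Euclidean norm `‖(u, v)‖ = √(‖u‖² + ‖v‖²)`. -/
abbrev EProd (E F : Type*) : Type _ := WithLp 2 (E × F)

/-- The element `(u, v)` of `EProd E F`. -/
abbrev pr {E F : Type*} (u : E) (v : F) : EProd E F := WithLp.toLp 2 (u, v)

/-- The graph of a multifunction. -/
def gph {E F : Type*} (S : E → Set F) : Set (EProd E F) :=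
  {p | p.snd ∈ S p.fst}

section Cones

variable {X : Type*} [NormedAddCommGroup X] [InnerProductSpace ℝ X]

/-- The tangent (contingent, Bouligand) cone to `A` at `x`, i.e. the outer limit of `(A - x) / t`
as `t ↓ 0`. -/
def tangentCone (A : Set X) (x : X) : Set X :=
  {w | ∃ (t : ℕ → ℝ) (v : ℕ → X), (∀ i, 0 < t i) ∧ Tendsto t atTop (𝓝 0) ∧
    Tendsto v atTop (𝓝 w) ∧ ∀ i, x + t i • v i ∈ A}

/-- The outer limiting tangent cone to `A` at `x`: the outer limit of the tangent cones `T_A(x')`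
as `x' → x` within `A`. -/
def outerLimitingTangentCone (A : Set X) (x : X) : Set X :=
  {w | ∃ (z : ℕ → X) (v : ℕ → X), (∀ i, z i ∈ A) ∧ Tendsto z atTop (𝓝 x) ∧
    (∀ i, v i ∈ tangentCone A (z i)) ∧ Tendsto v atTop (𝓝 w)}

/-- The regular (Fréchet) normal cone to `A` at `x`: the negative polar of the tangent cone. -/
def regularNormalCone (A : Set X) (x : X) : Set X :=
  {n | ∀ w ∈ tangentCone A x, inner ℝ n w ≤ 0}

/-- The semismooth* property of a set `A` at one of its points `x`. -/
def SemismoothStarSet (A : Set X) (x : X) : Prop :=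
  ∀ ε > (0 : ℝ), ∃ δ > (0 : ℝ), ∀ z ∈ A ∩ Metric.closedBall x δ, ∀ n ∈ regularNormalCone A z,
    |inner ℝ n (z - x)| ≤ ε * ‖z - x‖ * ‖n‖

end Cones

section Derivatives

variable {E G : Type*} [NormedAddCommGroup E] [InnerProductSpace ℝ E]
  [NormedAddCommGroup G] [InnerProductSpace ℝ G]

/-- The graphical derivative `DF(p)` at a point `p` of the graph of `F`. -/
def graphicalDeriv (F : E → Set G) (p : EProd E G) : E → Set G :=
  fun u => {w | pr u w ∈ tangentCone (gph F) p}

/-- The outer limiting graphical derivative `D^♯F(p)`. -/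
def outerLimitingGraphicalDeriv (F : E → Set G) (p : EProd E G) : E → Set G :=
  fun u => {w | pr u w ∈ outerLimitingTangentCone (gph F) p}

/-- The regular (Fréchet) coderivative of `F` at `p`. -/
def regularCoderiv (F : E → Set G) (p : EProd E G) : G → Set E :=
  fun y' => {x' | pr x' (-y') ∈ regularNormalCone (gph F) p}

/-- The semismooth* property of a multifunction at a point of its graph. -/
def SemismoothStarAt (F : E → Set G) (p : EProd E G) : Prop :=
  SemismoothStarSet (gph F) p

/-- `F` is semismooth* at all points of its graph close to `p`. -/
def SemismoothStarAround (F : E → Set G) (p : EProd E G) : Prop :=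
  ∃ W ∈ 𝓝 p, ∀ q ∈ gph F ∩ W, SemismoothStarAt F q

variable [FiniteDimensional ℝ E] [FiniteDimensional ℝ G]

variable (E G) in
/-- The family of all `n`-dimensional subspaces of `E × G`, where `n = dim E`. -/
def ZSpace : Set (Submodule ℝ (EProd E G)) :=
  {L | Module.finrank ℝ L = Module.finrank ℝ E}

/-- The metric `‖P₁ - P₂‖` on subspaces, where `Pᵢ` is the orthogonal projection onto `Lᵢ` and
the norm is the operator norm. -/
noncomputable def distZ (L₁ L₂ : Submodule ℝ (EProd E G)) : ℝ :=
  ‖L₁.starProjection - L₂.starProjection‖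

/-- `O_F`: the points of the graph of `F` at which the tangent cone to the graph is a subspace of
dimension `dim E`. -/
def smoothPoints (F : E → Set G) : Set (EProd E G) :=
  {p | p ∈ gph F ∧ ∃ L ∈ ZSpace E G, (L : Set (EProd E G)) = tangentCone (gph F) p}

/-- The SC limiting graphical derivative `𝒮F(p)`: all limits of subspaces
`gph DF(q i)` along sequences `q i → p` in `O_F`. -/
def scLimitingGraphicalDeriv (F : E → Set G) (p : EProd E G) :
    Set (Submodule ℝ (EProd E G)) :=
  {L | L ∈ ZSpace E G ∧ ∃ (q : ℕ → EProd E G) (M : ℕ → Submodule ℝ (EProd E G)),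
    (∀ i, q i ∈ smoothPoints F) ∧ Tendsto q atTop (𝓝 p) ∧
    (∀ i, M i ∈ ZSpace E G ∧ (M i : Set (EProd E G)) = gph (graphicalDeriv F (q i))) ∧
    Tendsto (fun i => distZ L (M i)) atTop (𝓝 0)}

/-- The SC limiting coderivative `𝒮*F(p)`: all limits of subspaces
`gph D̂*F(q i)` along sequences `q i → p` in `O_F`. -/
def scLimitingCoderiv (F : E → Set G) (p : EProd E G) :
    Set (Submodule ℝ (EProd G E)) :=
  {L | L ∈ ZSpace G E ∧ ∃ (q : ℕ → EProd E G) (M : ℕ → Submodule ℝ (EProd G E)),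
    (∀ i, q i ∈ smoothPoints F) ∧ Tendsto q atTop (𝓝 p) ∧
    (∀ i, M i ∈ ZSpace G E ∧ (M i : Set (EProd G E)) = gph (regularCoderiv F (q i))) ∧
    Tendsto (fun i => distZ L (M i)) atTop (𝓝 0)}

/-- The SCD (subspace containing derivative) property at a point of the graph. -/
def SCDPropertyAt (F : E → Set G) (p : EProd E G) : Prop :=
  (scLimitingCoderiv F p).Nonempty

/-- `F` has the SCD property at all points of its graph close to `p`. -/
def SCDPropertyAround (F : E → Set G) (p : EProd E G) : Prop :=
  ∃ W ∈ 𝓝 p, ∀ q ∈ gph F ∩ W, SCDPropertyAt F q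

end Derivatives

section Calmness

variable {E G : Type*} [NormedAddCommGroup E] [NormedAddCommGroup G]

/-- `S` is isolatedly calm with constant `κ` at the point `p = (ȳ, x̄)` of its graph:
`S(y) ∩ U ⊆ {x̄} + κ ‖y - ȳ‖ 𝔹` for all `y`, for some neighborhood `U` of `x̄`. -/
def IsolatedlyCalmAt (S : E → Set G) (κ : ℝ) (p : EProd E G) : Prop :=
  ∃ U ∈ 𝓝 p.snd, ∀ y : E, S y ∩ U ⊆ Metric.closedBall p.snd (κ * ‖y - p.fst‖)

/-- `S` is isolatedly calm around `p` (isolatedly calm on a neighborhood): it is isolatedly calm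
with one common constant `κ` at all points of its graph close to `p`. -/
def IsolatedlyCalmAround (S : E → Set G) (p : EProd E G) : Prop :=
  ∃ κ : ℝ, 0 ≤ κ ∧ ∃ W ∈ 𝓝 p, ∀ q ∈ gph S ∩ W, IsolatedlyCalmAt S κ q

end Calmness

/-- The implicit solution map `Σ(x) = {y | 0 ∈ H(x, y)}`. -/
def solutionMap {X Y Z : Type*} [Zero Z] (H : EProd X Y → Set Z) : X → Set Y :=
  fun x => {y | 0 ∈ H (pr x y)}

end SCD

namespace SCD

/-! For (i), suppose isolated calmness fails with ever larger constants at points `q` tending to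
`p`. Normalizing differences of solutions by their `y`-part gives tangent directions `((u, v), 0)`
to the graph of `H` at `(q, 0)` with `u → 0` and `‖v‖ = 1`; a cluster point violates (i).

Condition (ii) with (P) reduces to (i), since every outer limiting tangent `w` lies in some `L ∈ 𝒮H`
(`exists_mem_scLimitingGraphicalDeriv`). Near a graph point `q + t v` with `v ≈ w`, SCD supplies a
smooth point `z` with tangent subspace `L`. Semismoothness* makes the normal `w - P_L w` almost
orthogonal to `z - q ≈ t w`, so `‖w - P_L w‖` is small; compactness of the Grassmannian yields a
limit subspace containing `w`.

(P) and (D) agree by linear algebra: passing to adjoints (rotated orthogonal complements) is a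
`distZ`-isometry carrying `𝒮H` onto `𝒮*H`. (P) says that `L` meets `{((0, v), 0)}` trivially; the
dimensions are complementary, so this amounts to the trivial intersection of the orthogonal
complements, which is (D). -/

/-- Extensionality for elements of the Euclidean product. -/
@[ext]
theorem eprod_ext {E F : Type*} {x y : EProd E F} (h₁ : x.fst = y.fst) (h₂ : x.snd = y.snd) :
    x = y :=
  WithLp.ofLp_injective 2 (Prod.ext h₁ h₂)

/-- If the tangent cone is a subspace, the regular normal cone is its orthogonal complement. -/
theorem regularNormalCone_eq_orthogonal {X : Type*} [NormedAddCommGroup X]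
    [InnerProductSpace ℝ X] {A : Set X} {x : X} {L : Submodule ℝ X}
    (hL : (L : Set X) = tangentCone A x) : regularNormalCone A x = (Lᗮ : Submodule ℝ X) := by
  ext n
  simp only [regularNormalCone, ← hL, Set.mem_ofPred_eq, SetLike.mem_coe,
    Submodule.mem_orthogonal']
  refine ⟨fun h w hw => le_antisymm (h w hw) ?_, fun h w hw => (h w hw).le⟩
  simpa using h (-w) (L.neg_mem hw)

/-! ### Orthogonal projections and compactness of the Grassmannian. -/

section Projections

variable {X : Type*} [NormedAddCommGroup X] [InnerProductSpace ℝ X] [FiniteDimensional ℝ X]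

/-- The trace of the orthogonal projection onto a subspace is its dimension. -/
theorem trace_starProjection (L : Submodule ℝ X) :
    LinearMap.trace ℝ X (L.starProjection : X →ₗ[ℝ] X) = Module.finrank ℝ L := by
  refine LinearMap.IsProj.trace (p := L) ⟨fun x => ?_, fun x hx => ?_⟩
  · exact L.starProjection_apply_mem x
  · exact L.starProjection_eq_self_iff.2 hx

/-- The Grassmannian of subspaces of a fixed dimension is sequentially compact for the
projection metric. -/
theorem exists_subseq_tendsto_starProjection (d : ℕ) (M : ℕ → Submodule ℝ X)
    (hM : ∀ i, Module.finrank ℝ (M i) = d) :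
    ∃ L : Submodule ℝ X, Module.finrank ℝ L = d ∧ ∃ φ : ℕ → ℕ, StrictMono φ ∧
      Tendsto (fun i => (M (φ i)).starProjection) atTop (𝓝 L.starProjection) := by
  have : ProperSpace (X →L[ℝ] X) := FiniteDimensional.proper ℝ _
  obtain ⟨P, -, φ, hφ, hlim⟩ := tendsto_subseq_of_bounded
    (x := fun i => (M i).starProjection)
    (Metric.isBounded_closedBall (x := (0 : X →L[ℝ] X)) (r := 1))
    (fun i => mem_closedBall_zero_iff.2 (M i).starProjection_norm_le)
  -- Idempotence and self-adjointness are closed conditions, so the limit is again an orthogonal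
  -- projection.
  have hP : IsStarProjection P := by
    constructor
    · refine tendsto_nhds_unique ((hlim.mul hlim).congr fun i => ?_) hlim
      exact (M (φ i)).isIdempotentElem_starProjection
    · refine tendsto_nhds_unique (hlim.star.congr fun i => ?_) hlim
      exact isSelfAdjoint_starProjection (M (φ i))
  obtain ⟨L, _, rfl⟩ := isStarProjection_iff_eq_starProjection.1 hP
  refine ⟨L, ?_, φ, hφ, hlim⟩
  have hcont : Continuous ((LinearMap.trace ℝ X).comp
      (ContinuousLinearMap.coeLM ℝ : (X →L[ℝ] X) →ₗ[ℝ] (X →ₗ[ℝ] X))) :=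
    LinearMap.continuous_of_finiteDimensional _
  have h := (hcont.tendsto L.starProjection).comp hlim
  -- Continuity of the trace keeps the dimension from changing in the limit.
  have h' : Tendsto (fun _ : ℕ => (d : ℝ)) atTop (𝓝 (Module.finrank ℝ L : ℝ)) := by
    rw [← trace_starProjection L]
    refine h.congr fun i => ?_
    rw [← hM (φ i), ← trace_starProjection (M (φ i))]
    rfl
  exact_mod_cast tendsto_nhds_unique h' tendsto_const_nhds

/-- Distance estimate: if `x` is close to `w` and almost orthogonal to `w - P_L w`, then `w` is
close to `L`. -/
theorem norm_sub_starProjection_le (L : Submodule ℝ X) {w x : X} {a b : ℝ}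
    (ha : 0 ≤ a) (hx : |inner ℝ (w - L.starProjection w) x| ≤ a * ‖w - L.starProjection w‖)
    (hxw : ‖w - x‖ ≤ b) : ‖w - L.starProjection w‖ ≤ a + b := by
  set n := w - L.starProjection w with hn
  have hnL : n ∈ Lᗮ := L.sub_starProjection_mem_orthogonal w
  have h1 : inner ℝ n n = inner ℝ n x + inner ℝ n (w - x) := by
    rw [← inner_add_right]
    have : x + (w - x) = n + L.starProjection w := by rw [hn]; abel
    rw [this, inner_add_right, L.inner_left_of_mem_orthogonal (L.starProjection_apply_mem w) hnL,
      add_zero]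
  rw [real_inner_self_eq_norm_sq] at h1
  have h2 : inner ℝ n (w - x) ≤ ‖n‖ * b :=
    (real_inner_le_norm _ _).trans (by gcongr)
  have h3 := (le_abs_self _).trans hx
  rcases (norm_nonneg n).eq_or_lt with h0 | h0
  · rw [← h0]
    have : 0 ≤ b := (norm_nonneg _).trans hxw
    positivity
  · nlinarith

/-- If two subspaces of complementary dimensions meet only at zero, so do their orthogonal
complements. -/
theorem orthogonal_inf_orthogonal_eq_bot {L V : Submodule ℝ X}
    (h : Module.finrank ℝ L + Module.finrank ℝ V = Module.finrank ℝ X) (hLV : L ⊓ V = ⊥) :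
    Lᗮ ⊓ Vᗮ = ⊥ := by
  have h1 := Submodule.finrank_sup_add_finrank_inf_eq L V
  rw [hLV, finrank_bot, add_zero, h] at h1
  rw [Submodule.inf_orthogonal, Submodule.eq_top_of_finrank_eq h1, Submodule.top_orthogonal_eq_bot]

theorem inf_eq_bot_iff_orthogonal {L V : Submodule ℝ X}
    (h : Module.finrank ℝ L + Module.finrank ℝ V = Module.finrank ℝ X) :
    L ⊓ V = ⊥ ↔ Lᗮ ⊓ Vᗮ = ⊥ := by
  refine ⟨orthogonal_inf_orthogonal_eq_bot h, fun h' => ?_⟩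
  have hL := L.finrank_add_finrank_orthogonal
  have hV := V.finrank_add_finrank_orthogonal
  simpa using orthogonal_inf_orthogonal_eq_bot (L := Lᗮ) (V := Vᗮ) (by omega) h'

end Projections

/-! ### Adjoint subspaces, linking tangent spaces to coderivatives. -/

section Adjoint

variable {E G : Type*} [NormedAddCommGroup E] [InnerProductSpace ℝ E]
  [NormedAddCommGroup G] [InnerProductSpace ℝ G]

variable (E G) in
/-- The rotation `(x, y) ↦ (-y, x)`. -/
noncomputable def rotation : EProd E G ≃ₗᵢ[ℝ] EProd G E :=
  (LinearIsometryEquiv.withLpProdComm 2 ℝ E G).trans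
    (LinearIsometryEquiv.withLpProdCongr 2 (LinearIsometryEquiv.neg ℝ) (LinearIsometryEquiv.refl ℝ E))

theorem rotation_symm_apply (z : EProd G E) : (rotation E G).symm z = pr z.snd (-z.fst) := by
  rw [LinearIsometryEquiv.symm_apply_eq]
  simp only [rotation, LinearIsometryEquiv.trans_apply, LinearIsometryEquiv.withLpProdComm_apply,
    LinearIsometryEquiv.withLpProdCongr_apply]
  ext <;> simp

/-- The adjoint of a subspace `L`, consisting of all `(y', x')` with `(x', -y') ∈ Lᗮ`. -/
noncomputable def adjointSubspace (L : Submodule ℝ (EProd E G)) : Submodule ℝ (EProd G E) :=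
  Lᗮ.map ((rotation E G).toLinearEquiv : EProd E G →ₗ[ℝ] EProd G E)

theorem mem_adjointSubspace {L : Submodule ℝ (EProd E G)} {z : EProd G E} :
    z ∈ adjointSubspace L ↔ pr z.snd (-z.fst) ∈ Lᗮ := by
  rw [adjointSubspace, Submodule.mem_map_equiv, ← rotation_symm_apply]
  rfl

theorem gph_regularCoderiv_eq {F : E → Set G} {p : EProd E G} {L : Submodule ℝ (EProd E G)}
    (hL : (L : Set (EProd E G)) = tangentCone (gph F) p) :
    gph (regularCoderiv F p) = adjointSubspace L := by
  ext z
  rw [SetLike.mem_coe, mem_adjointSubspace, ← SetLike.mem_coe, ← regularNormalCone_eq_orthogonal hL]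
  rfl

variable [FiniteDimensional ℝ E] [FiniteDimensional ℝ G]

theorem finrank_eprod : Module.finrank ℝ (EProd E G) = Module.finrank ℝ E + Module.finrank ℝ G := by
  rw [(WithLp.linearEquiv 2 ℝ (E × G)).finrank_eq, Module.finrank_prod]

theorem adjointSubspace_mem_ZSpace {L : Submodule ℝ (EProd E G)} :
    adjointSubspace L ∈ ZSpace G E ↔ L ∈ ZSpace E G := by
  have h := L.finrank_add_finrank_orthogonal
  rw [finrank_eprod] at h
  simp only [ZSpace, adjointSubspace, Set.mem_ofPred_eq, LinearEquiv.finrank_map_eq]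
  omega

theorem adjointSubspace_surjective :
    Function.Surjective (adjointSubspace : Submodule ℝ (EProd E G) → Submodule ℝ (EProd G E)) := by
  intro M
  refine ⟨(M.map ((rotation E G).symm.toLinearEquiv : EProd G E →ₗ[ℝ] EProd E G))ᗮ, ?_⟩
  rw [adjointSubspace, Submodule.orthogonal_orthogonal]
  ext z
  simp

/-- Projections onto complements are `1 - P`, so their difference only changes sign, and conjugation
by the isometric rotation preserves the operator norm. -/
theorem distZ_adjointSubspace (L M : Submodule ℝ (EProd E G)) :
    distZ (adjointSubspace L) (adjointSubspace M) = distZ L M := by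
  have h : (adjointSubspace L).starProjection - (adjointSubspace M).starProjection =
      ((rotation E G).toContinuousLinearEquiv : EProd E G →L[ℝ] EProd G E).comp
        ((M.starProjection - L.starProjection).comp
          ((rotation E G).symm.toContinuousLinearEquiv : EProd G E →L[ℝ] EProd E G)) := by
    ext1 z
    simp [adjointSubspace, Submodule.starProjection_map_apply, Submodule.starProjection_orthogonal]
  rw [distZ, distZ, h, norm_sub_rev L.starProjection]
  refine (LinearIsometry.norm_toContinuousLinearMap_comp
    (rotation E G).toLinearIsometry).trans ?_
  exact ContinuousLinearMap.opNorm_comp_linearIsometryEquiv _ (rotation E G).symm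

/-- The SC limiting coderivative consists of the adjoints of the elements of the SC limiting
graphical derivative. -/
theorem adjointSubspace_mem_scLimitingCoderiv {F : E → Set G} {p : EProd E G}
    {L : Submodule ℝ (EProd E G)} :
    adjointSubspace L ∈ scLimitingCoderiv F p ↔ L ∈ scLimitingGraphicalDeriv F p := by
  refine and_congr adjointSubspace_mem_ZSpace ⟨?_, ?_⟩
  · rintro ⟨q, M, hq, hqp, hM, hlim⟩
    choose N hN hNT using fun i => (hq i).2
    have hMN : ∀ i, M i = adjointSubspace (N i) := fun i =>
      SetLike.coe_injective ((hM i).2.trans (gph_regularCoderiv_eq (hNT i)))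
    refine ⟨q, N, hq, hqp, fun i => ⟨hN i, hNT i⟩, ?_⟩
    simpa only [hMN, distZ_adjointSubspace] using hlim
  · rintro ⟨q, M, hq, hqp, hM, hlim⟩
    refine ⟨q, fun i => adjointSubspace (M i), hq, hqp, fun i =>
      ⟨adjointSubspace_mem_ZSpace.2 (hM i).1, (gph_regularCoderiv_eq (hM i).2).symm⟩, ?_⟩
    simpa only [distZ_adjointSubspace] using hlim

end Adjoint

/-! ### Outer limiting tangents of semismooth* SCD multifunctions. -/

section Semismooth

variable {E G : Type*} [NormedAddCommGroup E] [InnerProductSpace ℝ E]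
  [NormedAddCommGroup G] [InnerProductSpace ℝ G] [FiniteDimensional ℝ E] [FiniteDimensional ℝ G]

theorem SCDPropertyAt.mem_closure_smoothPoints {F : E → Set G} {p : EProd E G}
    (h : SCDPropertyAt F p) : p ∈ closure (smoothPoints F) := by
  obtain ⟨L, -, q, M, hq, hqp, -⟩ := h
  exact mem_closure_of_tendsto hqp (Eventually.of_forall hq)

/-- Tangent directions at a point where the multifunction is semismooth* are approximated by
tangent subspaces at nearby smooth points. -/
theorem exists_tangent_subspace_near {F : E → Set G} {q : EProd E G}
    (hss : SemismoothStarAt F q) (hscd : SCDPropertyAround F q) {w : EProd E G}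
    (hw : w ∈ tangentCone (gph F) q) {ε : ℝ} (hε : 0 < ε) :
    ∃ (z : EProd E G) (L : Submodule ℝ (EProd E G)), z ∈ smoothPoints F ∧ dist z q ≤ ε ∧
      L ∈ ZSpace E G ∧ (L : Set (EProd E G)) = tangentCone (gph F) z ∧
      ‖w - L.starProjection w‖ ≤ ε := by
  obtain ⟨t, v, ht, ht0, hv, hA⟩ := hw
  obtain ⟨W, hW, hWscd⟩ := hscd
  -- The rescaled point `x` below satisfies `‖w - x‖ ≤ 2η`: the bound `η ≤ 1` gives `‖x‖ ≤ C`, and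
  -- `η ≤ ε / 4` leaves `ε / 2` for the semismoothness* error, whence the tolerance `ε / (2 * C)`.
  set η : ℝ := min 1 (ε / 4)
  have hη : 0 < η := by positivity
  set C : ℝ := ‖w‖ + 2
  have hC : 0 < C := by positivity
  obtain ⟨δ, hδ, hsemi⟩ := hss (ε / (2 * C)) (by positivity)
  have hlim : Tendsto (fun i => q + t i • v i) atTop (𝓝 q) := by
    simpa using tendsto_const_nhds.add (ht0.smul hv)
  obtain ⟨i, hiW, hit, hiv⟩ := ((hlim.eventually hW).and
    ((ht0.eventually_le_const (show (0 : ℝ) < min δ ε / C by positivity)).and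
      (Metric.tendsto_nhds.1 hv η hη))).exists
  -- The accuracy is proportional to `t i`, so that it survives division by `t i`.
  obtain ⟨z, hz, hzd⟩ := Metric.mem_closure_iff.1
    (hWscd _ ⟨hA i, hiW⟩).mem_closure_smoothPoints (t i * η) (mul_pos (ht i) hη)
  obtain ⟨hzF, L, hL, hLT⟩ := hz
  have hti := ht i
  set x := (t i)⁻¹ • (z - q) with hx
  have hzq : z - q = t i • x := by rw [hx, smul_inv_smul₀ hti.ne']
  have hxv : ‖v i - x‖ ≤ η := by
    have h1 : q + t i • v i - z = t i • (v i - x) := by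
      rw [smul_sub, ← hzq]; abel
    rw [dist_eq_norm, h1, norm_smul, Real.norm_of_nonneg hti.le] at hzd
    exact (lt_of_mul_lt_mul_left hzd hti.le).le
  have hxw : ‖w - x‖ ≤ 2 * η := by
    rw [dist_eq_norm, norm_sub_rev] at hiv
    calc ‖w - x‖ = ‖(w - v i) + (v i - x)‖ := by congr 1; abel
      _ ≤ _ := norm_add_le _ _
      _ ≤ 2 * η := by linarith
  have hη1 : η ≤ 1 := min_le_left _ _
  have hη2 : η ≤ ε / 4 := min_le_right _ _
  have hxC : ‖x‖ ≤ C := by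
    calc ‖x‖ = ‖w - (w - x)‖ := by congr 1; abel
      _ ≤ _ := norm_sub_le _ _
      _ ≤ C := by simp only [C]; linarith
  have hzqn : ‖z - q‖ ≤ min δ ε := by
    rw [hzq, norm_smul, Real.norm_of_nonneg hti.le]
    calc t i * ‖x‖ ≤ min δ ε / C * C := by gcongr
      _ = _ := by field_simp
  refine ⟨z, L, ⟨hzF, L, hL, hLT⟩, ?_, hL, hLT, ?_⟩
  · rw [dist_eq_norm]; exact hzqn.trans (min_le_right _ _)
  · have hn : w - L.starProjection w ∈ regularNormalCone (gph F) z := by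
      rw [regularNormalCone_eq_orthogonal hLT]
      exact L.sub_starProjection_mem_orthogonal w
    have h := hsemi z ⟨hzF, by
      rw [Metric.mem_closedBall, dist_eq_norm]; exact hzqn.trans (min_le_left _ _)⟩ _ hn
    rw [hzq, inner_smul_right, abs_mul, abs_of_pos hti, norm_smul, Real.norm_of_nonneg hti.le] at h
    have h' : |inner ℝ (w - L.starProjection w) x| ≤ ε / 2 * ‖w - L.starProjection w‖ := by
      refine le_of_mul_le_mul_left (h.trans ?_) hti
      calc ε / (2 * C) * (t i * ‖x‖) * ‖w - L.starProjection w‖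
          ≤ ε / (2 * C) * (t i * C) * ‖w - L.starProjection w‖ := by gcongr
        _ = t i * (ε / 2 * ‖w - L.starProjection w‖) := by field_simp
    have := norm_sub_starProjection_le L (by positivity) h' hxw
    linarith

/-- For a semismooth* SCD multifunction, the outer limiting tangent cone to the graph is covered
by the SC limiting graphical derivative. -/
theorem exists_mem_scLimitingGraphicalDeriv {F : E → Set G} {p : EProd E G}
    (hss : SemismoothStarAround F p) (hscd : SCDPropertyAround F p) {w : EProd E G}
    (hw : w ∈ outerLimitingTangentCone (gph F) p) :
    ∃ L ∈ scLimitingGraphicalDeriv F p, w ∈ L := by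
  obtain ⟨q, v, hq, hqp, hv, hvw⟩ := hw
  obtain ⟨W₁, hW₁, hss⟩ := hss
  obtain ⟨W₂, hW₂, hscd⟩ := hscd
  have key : ∀ j : ℕ, ∃ (z : EProd E G) (L : Submodule ℝ (EProd E G)), z ∈ smoothPoints F ∧
      L ∈ ZSpace E G ∧ (L : Set (EProd E G)) = tangentCone (gph F) z ∧
      dist z p ≤ 1 / ((j : ℝ) + 1) ∧ ‖w - L.starProjection w‖ ≤ 1 / ((j : ℝ) + 1) := by
    intro j
    have hε : (0 : ℝ) < 1 / ((j : ℝ) + 1) := by positivity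
    set ε : ℝ := 1 / ((j : ℝ) + 1)
    -- The residual of `w` is at most that of `v i` (`ε / 2`) plus `‖w - v i‖` (`ε / 4`).
    obtain ⟨i, h1, h2, h3, h4⟩ := ((hqp.eventually hW₁).and
      ((hqp.eventually (eventually_mem_nhds_iff.2 hW₂)).and
      ((Metric.tendsto_nhds.1 hqp (ε / 2) (half_pos hε)).and
      (Metric.tendsto_nhds.1 hvw (ε / 4) (by positivity))))).exists
    obtain ⟨z, L, hz, hzq, hL, hLT, hd⟩ := exists_tangent_subspace_near (hss _ ⟨hq i, h1⟩)
      ⟨W₂, h2, hscd⟩ (hv i) (show 0 < ε / 2 by positivity)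
    refine ⟨z, L, hz, hL, hLT, ?_, ?_⟩
    · linarith [dist_triangle z (q i) p]
    · have e : w - L.starProjection w = (v i - L.starProjection (v i)) +
          ((w - v i) - L.starProjection (w - v i)) := by rw [map_sub]; abel
      have h5 : ‖(w - v i) - L.starProjection (w - v i)‖ ≤ ‖w - v i‖ := by
        have := Lᗮ.norm_starProjection_apply_le (w - v i)
        simpa [Submodule.starProjection_orthogonal] using this
      rw [dist_eq_norm, norm_sub_rev] at h4
      rw [e]
      refine (norm_add_le _ _).trans ?_
      linarith
  choose z M hz hMZ hMT hzp hMw using key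
  obtain ⟨L, hL, φ, hφ, hlim⟩ := exists_subseq_tendsto_starProjection (Module.finrank ℝ E) M hMZ
  have hε0 : Tendsto (fun j : ℕ => 1 / ((j : ℝ) + 1)) atTop (𝓝 0) :=
    tendsto_one_div_add_atTop_nhds_zero_nat
  have hzlim : Tendsto z atTop (𝓝 p) :=
    tendsto_iff_dist_tendsto_zero.2 (squeeze_zero (fun _ => dist_nonneg) hzp hε0)
  refine ⟨L, ⟨hL, z ∘ φ, M ∘ φ, fun i => hz _, hzlim.comp hφ.tendsto_atTop,
    fun i => ⟨hMZ _, hMT _⟩, ?_⟩, ?_⟩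
  · have h := tendsto_iff_norm_sub_tendsto_zero.1 hlim
    simpa only [distZ, norm_sub_rev L.starProjection, Function.comp_apply] using h
  · have h1 : Tendsto (fun i => ‖w - (M (φ i)).starProjection w‖) atTop (𝓝 0) :=
      squeeze_zero (fun _ => norm_nonneg _) (fun i => hMw (φ i)) (hε0.comp hφ.tendsto_atTop)
    have h2 : Tendsto (fun i => ‖w - (M (φ i)).starProjection w‖) atTop
        (𝓝 ‖w - L.starProjection w‖) :=
      (tendsto_const_nhds.sub
        (((ContinuousLinearMap.apply ℝ (EProd E G) w).continuous.tendsto _).comp hlim)).norm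
    have h3 := norm_eq_zero.1 (tendsto_nhds_unique h2 h1)
    exact L.starProjection_eq_self_iff.1 (sub_eq_zero.1 h3).symm

end Semismooth

/-! ### Isolated calmness from tangent directions. -/

section SolutionMap

variable {X Y Z : Type*} [NormedAddCommGroup X] [InnerProductSpace ℝ X]
  [NormedAddCommGroup Y] [InnerProductSpace ℝ Y] [NormedAddCommGroup Z] [InnerProductSpace ℝ Z]

theorem tendsto_pr {ι A B : Type*} [TopologicalSpace A] [TopologicalSpace B] {f : Filter ι}
    {u : ι → A} {v : ι → B} {a : A} {b : B} (hu : Tendsto u f (𝓝 a)) (hv : Tendsto v f (𝓝 b)) :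
    Tendsto (fun i => pr (u i) (v i)) f (𝓝 (pr a b)) :=
  ((WithLp.prod_continuous_toLp 2 A B).tendsto (a, b)).comp (hu.prodMk_nhds hv)

/-- Failure of isolated calmness of the solution map with constant `κ` yields a tangent direction
`((u, v), 0)` with `‖u‖ ≤ 1 / κ` and `‖v‖ = 1`. -/
theorem exists_tangent_of_not_isolatedlyCalmAt [FiniteDimensional ℝ X] [FiniteDimensional ℝ Y]
    {H : EProd X Y → Set Z} {q : EProd X Y} {κ : ℝ} (hκ : 0 < κ)
    (h : ¬ IsolatedlyCalmAt (solutionMap H) κ q) :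
    ∃ (u : X) (v : Y), ‖u‖ ≤ 1 / κ ∧ ‖v‖ = 1 ∧
      pr (pr u v) 0 ∈ tangentCone (gph H) (pr q 0) := by
  have key : ∀ j : ℕ, ∃ (x : X) (y : Y), 0 ∈ H (pr x y) ∧ dist y q.snd < 1 / ((j : ℝ) + 1) ∧
      κ * ‖x - q.fst‖ < ‖y - q.snd‖ := by
    intro j
    by_contra! hcon
    refine h ⟨Metric.ball q.snd (1 / ((j : ℝ) + 1)), Metric.ball_mem_nhds _ (by positivity), ?_⟩
    rintro x y ⟨hy, hyU⟩
    rw [Metric.mem_closedBall, dist_eq_norm]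
    exact hcon x y hy hyU
  choose x y hxy hyq hcalm using key
  -- Scaling by the `y`-increment is always possible, since it is positive even when `x j = q.fst`.
  set t : ℕ → ℝ := fun j => ‖y j - q.snd‖ with ht
  have ht0 : ∀ j, 0 < t j := fun j => lt_of_le_of_lt (by positivity) (hcalm j)
  have htlim : Tendsto t atTop (𝓝 0) :=
    squeeze_zero (fun j => (ht0 j).le) (fun j => by
      simpa only [ht, ← dist_eq_norm] using (hyq j).le)
      tendsto_one_div_add_atTop_nhds_zero_nat
  set u : ℕ → X := fun j => (t j)⁻¹ • (x j - q.fst)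
  set v : ℕ → Y := fun j => (t j)⁻¹ • (y j - q.snd)
  have hu : ∀ j, ‖u j‖ ≤ 1 / κ := fun j => by
    rw [norm_smul, norm_inv, Real.norm_of_nonneg (ht0 j).le, inv_mul_le_iff₀ (ht0 j),
      mul_one_div, le_div_iff₀ hκ, mul_comm]
    exact (hcalm j).le
  have hv : ∀ j, ‖v j‖ = 1 := fun j => by
    rw [norm_smul, norm_inv, Real.norm_of_nonneg (ht0 j).le]
    exact inv_mul_cancel₀ (ht0 j).ne'
  obtain ⟨⟨a, b⟩, hab, φ, hφ, hlim⟩ := ((isCompact_closedBall (0 : X) (1 / κ)).prod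
    (isCompact_sphere (0 : Y) 1)).tendsto_subseq
    (x := fun j => (u j, v j)) (fun j => ⟨by simpa using hu j, by simpa using hv j⟩)
  refine ⟨a, b, by simpa using hab.1, by simpa using hab.2, t ∘ φ,
    fun j => pr (pr (u (φ j)) (v (φ j))) 0, fun j => ht0 _, htlim.comp hφ.tendsto_atTop, ?_, ?_⟩
  · exact tendsto_pr (tendsto_pr ((continuous_fst.tendsto _).comp hlim)
      ((continuous_snd.tendsto _).comp hlim)) tendsto_const_nhds
  · intro j
    have e : pr q (0 : Z) + t (φ j) • pr (pr (u (φ j)) (v (φ j))) 0 =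
        pr (pr (x (φ j)) (y (φ j))) 0 := by
      ext <;> simp [u, v, smul_inv_smul₀ (ht0 (φ j)).ne']
    rw [Function.comp_apply, e]
    exact hxy (φ j)

/-- The outer limiting graphical derivative criterion for isolated calmness of the solution map
on a neighborhood. -/
theorem isolatedlyCalmAround_solutionMap [FiniteDimensional ℝ X] [FiniteDimensional ℝ Y]
    {H : EProd X Y → Set Z} {p : EProd X Y}
    (h : ∀ v : Y, 0 ∈ outerLimitingGraphicalDeriv H (pr p 0) (pr 0 v) → v = 0) :
    IsolatedlyCalmAround (solutionMap H) p := by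
  by_contra hcon
  have key : ∀ j : ℕ, ∃ (q : EProd X Y) (u : X) (v : Y), q ∈ gph (solutionMap H) ∧
      dist q p < 1 / ((j : ℝ) + 1) ∧ ‖u‖ ≤ 1 / ((j : ℝ) + 1) ∧ ‖v‖ = 1 ∧
      pr (pr u v) 0 ∈ tangentCone (gph H) (pr q 0) := by
    intro j
    have hj : (0 : ℝ) < (j : ℝ) + 1 := by positivity
    by_contra! hno
    -- Constant and radius are coupled: as `j` grows, `q → p` and `‖u‖ ≤ 1 / (j + 1)` tends to zero
    -- together.
    refine hcon ⟨(j : ℝ) + 1, hj.le, Metric.ball p (1 / ((j : ℝ) + 1)),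
      Metric.ball_mem_nhds _ (by positivity), ?_⟩
    rintro q ⟨hq, hqp⟩
    by_contra hcalm
    obtain ⟨u, v, hu, hv, hT⟩ := exists_tangent_of_not_isolatedlyCalmAt hj hcalm
    exact hno q u v hq hqp hu hv hT
  choose q u v hq hqp hu hv hT using key
  have hε0 : Tendsto (fun j : ℕ => 1 / ((j : ℝ) + 1)) atTop (𝓝 0) :=
    tendsto_one_div_add_atTop_nhds_zero_nat
  have hqlim : Tendsto q atTop (𝓝 p) :=
    tendsto_iff_dist_tendsto_zero.2 (squeeze_zero (fun _ => dist_nonneg) (fun j => (hqp j).le) hε0)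
  have hulim : Tendsto u atTop (𝓝 0) := squeeze_zero_norm hu hε0
  obtain ⟨b, hb, φ, hφ, hlim⟩ := (isCompact_sphere (0 : Y) 1).tendsto_subseq
    (x := v) (fun j => by simpa using hv j)
  have hb0 : b = 0 := h b ⟨fun j => pr (q (φ j)) 0, fun j => pr (pr (u (φ j)) (v (φ j))) 0,
    fun j => hq (φ j), tendsto_pr (hqlim.comp hφ.tendsto_atTop) tendsto_const_nhds,
    fun j => hT (φ j),
    tendsto_pr (tendsto_pr (hulim.comp hφ.tendsto_atTop) hlim) tendsto_const_nhds⟩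
  simp [hb0] at hb

end SolutionMap

/-! ### Equivalence of the primal and dual conditions. -/

section Duality

variable {X Y Z : Type*} [NormedAddCommGroup X] [InnerProductSpace ℝ X]
  [NormedAddCommGroup Y] [InnerProductSpace ℝ Y] [NormedAddCommGroup Z] [InnerProductSpace ℝ Z]

variable (X Y Z) in
/-- The embedding `v ↦ ((0, v), 0)`. -/
def middleEmbedding : Y →ₗ[ℝ] EProd (EProd X Y) Z where
  toFun v := pr (pr 0 v) 0
  map_add' v w := by ext <;> simp
  map_smul' c v := by ext <;> simp

theorem mem_orthogonal_range_middleEmbedding {z : EProd (EProd X Y) Z} :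
    z ∈ (LinearMap.range (middleEmbedding X Y Z))ᗮ ↔ z.fst.snd = 0 := by
  rw [Submodule.mem_orthogonal]
  simp only [LinearMap.mem_range, forall_exists_index, forall_apply_eq_imp_iff]
  have e : ∀ v : Y, inner ℝ (middleEmbedding X Y Z v) z = inner ℝ v z.fst.snd := fun v => by
    simp [middleEmbedding, WithLp.prod_inner_apply]
  simp only [e]
  exact ⟨fun h => inner_self_eq_zero.1 (h _), fun h v => by rw [h, inner_zero_right]⟩

variable [FiniteDimensional ℝ X] [FiniteDimensional ℝ Y] [FiniteDimensional ℝ Z]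

/-- The primal and the dual nondegeneracy conditions on a subspace and its adjoint agree. -/
theorem primal_iff_dual_of_mem_ZSpace (hYZ : Module.finrank ℝ Y = Module.finrank ℝ Z)
    {L : Submodule ℝ (EProd (EProd X Y) Z)} (hL : L ∈ ZSpace (EProd X Y) Z) :
    (∀ v : Y, pr (pr 0 v) 0 ∈ L → v = 0) ↔
      ∀ (w : Z) (u : X), pr w (pr u 0) ∈ adjointSubspace L → w = 0 ∧ u = 0 := by
  have hinj : Function.Injective (middleEmbedding X Y Z) := fun v w hvw =>
    congrArg (fun z : EProd (EProd X Y) Z => z.fst.snd) hvw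
  -- Complementarity rests on `dim Y = dim Z`, as `L` has codimension `dim Z`.
  have hdim : Module.finrank ℝ L + Module.finrank ℝ (LinearMap.range (middleEmbedding X Y Z)) =
      Module.finrank ℝ (EProd (EProd X Y) Z) := by
    rw [LinearMap.finrank_range_of_inj hinj, finrank_eprod (E := EProd X Y), hYZ, hL]
  have hP : (∀ v : Y, pr (pr 0 v) 0 ∈ L → v = 0) ↔
      L ⊓ LinearMap.range (middleEmbedding X Y Z) = ⊥ := by
    rw [Submodule.eq_bot_iff]
    constructor
    · rintro h _ ⟨hz, v, rfl⟩
      rw [h v hz, map_zero]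
    · intro h v hv
      exact hinj ((h _ ⟨hv, v, rfl⟩).trans (map_zero _).symm)
  rw [hP, inf_eq_bot_iff_orthogonal hdim, Submodule.eq_bot_iff]
  constructor
  · intro h w u hwu
    have h0 := h _ ⟨mem_adjointSubspace.1 hwu, mem_orthogonal_range_middleEmbedding.2 rfl⟩
    exact ⟨neg_eq_zero.1 (congrArg (fun z : EProd (EProd X Y) Z => z.snd) h0),
      congrArg (fun z : EProd (EProd X Y) Z => z.fst.fst) h0⟩
  · rintro h z ⟨hzL, hz⟩
    have hz0 : z.fst.snd = 0 := mem_orthogonal_range_middleEmbedding.1 hz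
    -- The double negation matches the sign in the adjoint, with `w = -z.snd`.
    have e : pr (pr z.fst.fst (0 : Y)) (- -z.snd) = z := by
      ext <;> simp [hz0]
    obtain ⟨h1, h2⟩ := h (-z.snd) z.fst.fst (mem_adjointSubspace.2 (by
      show pr (pr z.fst.fst (0 : Y)) (- -z.snd) ∈ Lᗮ
      rw [e]; exact hzL))
    rw [← e, h1, h2, neg_zero]
    rfl

theorem primal_iff_dual (hYZ : Module.finrank ℝ Y = Module.finrank ℝ Z)
    (H : EProd X Y → Set Z) (p : EProd (EProd X Y) Z) :
    (∀ L ∈ scLimitingGraphicalDeriv H p, ∀ v : Y, pr (pr 0 v) 0 ∈ L → v = 0) ↔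
      ∀ L ∈ scLimitingCoderiv H p, ∀ (w : Z) (u : X), pr w (pr u 0) ∈ L → w = 0 ∧ u = 0 := by
  rw [(adjointSubspace_surjective (E := EProd X Y) (G := Z)).forall]
  refine forall_congr' fun L => ?_
  rw [adjointSubspace_mem_scLimitingCoderiv]
  exact forall_congr' fun hL => primal_iff_dual_of_mem_ZSpace hYZ hL.1

end Duality

end SCD

theorem theorem5p1 (l k : ℕ)
    (H : SCD.EProd (EuclideanSpace ℝ (Fin l)) (EuclideanSpace ℝ (Fin k)) →
      Set (EuclideanSpace ℝ (Fin k)))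
    (xbar : EuclideanSpace ℝ (Fin l)) (ybar : EuclideanSpace ℝ (Fin k))
    (hbar : SCD.pr (SCD.pr xbar ybar) 0 ∈ SCD.gph H) :
    -- condition (i)
    ((∀ v : EuclideanSpace ℝ (Fin k),
        0 ∈ SCD.outerLimitingGraphicalDeriv H (SCD.pr (SCD.pr xbar ybar) 0) (SCD.pr 0 v) → v = 0) →
      SCD.IsolatedlyCalmAround (SCD.solutionMap H) (SCD.pr xbar ybar)) ∧
    -- the primal and the dual implication in condition (ii) are equivalent
    ((∀ L ∈ SCD.scLimitingGraphicalDeriv H (SCD.pr (SCD.pr xbar ybar) 0),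
        ∀ v : EuclideanSpace ℝ (Fin k), SCD.pr (SCD.pr 0 v) 0 ∈ L → v = 0) ↔
      (∀ L ∈ SCD.scLimitingCoderiv H (SCD.pr (SCD.pr xbar ybar) 0),
        ∀ (w : EuclideanSpace ℝ (Fin k)) (u : EuclideanSpace ℝ (Fin l)),
          SCD.pr w (SCD.pr u 0) ∈ L → w = 0 ∧ u = 0)) ∧
    -- condition (ii)
    (SCD.SCDPropertyAround H (SCD.pr (SCD.pr xbar ybar) 0) →
      SCD.SemismoothStarAround H (SCD.pr (SCD.pr xbar ybar) 0) →
      ((∀ L ∈ SCD.scLimitingGraphicalDeriv H (SCD.pr (SCD.pr xbar ybar) 0),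
          ∀ v : EuclideanSpace ℝ (Fin k), SCD.pr (SCD.pr 0 v) 0 ∈ L → v = 0) ∨
        (∀ L ∈ SCD.scLimitingCoderiv H (SCD.pr (SCD.pr xbar ybar) 0),
          ∀ (w : EuclideanSpace ℝ (Fin k)) (u : EuclideanSpace ℝ (Fin l)),
            SCD.pr w (SCD.pr u 0) ∈ L → w = 0 ∧ u = 0)) →
      SCD.IsolatedlyCalmAround (SCD.solutionMap H) (SCD.pr xbar ybar)) := by
  have hdual := SCD.primal_iff_dual (H := H) rfl (SCD.pr (SCD.pr xbar ybar) 0)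
  refine ⟨SCD.isolatedlyCalmAround_solutionMap, hdual, fun hscd hss hPD => ?_⟩
  have hP := hPD.elim id hdual.2
  refine SCD.isolatedlyCalmAround_solutionMap fun v hv => ?_
  obtain ⟨L, hL, hvL⟩ := SCD.exists_mem_scLimitingGraphicalDeriv hss hscd hv
  exact hP L hL v hvL
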